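/- Let $k$ be a field, let $Q$ be a finite connected quiver (with vertex set $Q_0 \neq \emptyset$), and let $F$ be the two-sided ideal of the path algebra $kQ$ generated by the arrows. Let $I$ be an admissible ideal of $kQ$, that is, a two-sided ideal with $F^m \subseteq I \subseteq F^2$ for some $m \geq 2$, and assume that $I$ is monomial, that is, generated as a two-sided ideal by a set of paths. Put $A = kQ/I$, and let ${\rm HH}^i(A) = {\rm Ext}^i_{A^e}(A,A)$, where $A^e = A\otimes_k A^{op}$, be the Hochschild cohomology groups of $A$. Then the following are equivalent: (a) ${\rm HH}^i(A) = 0$ for all $i > 0$; (b) ${\rm HH}^1(A) = 0$; (c) $Q$ is a tree, that is, the underlying undirected multigraph of $Q$ (loops and multiple edges allowed) is connected and has no cycles; in particular, $Q$ then has no loops and no two distinct arrows with the same unordered pair of end points. -/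

import Mathlib

open scoped TensorProduct

namespace BoundQuiver

universe u v w

/-! ### Hochschild cohomology -/

/-- An algebra `A` over `k` as a module over its enveloping algebra `A ⊗[k] Aᵐᵒᵖ`, that is, as a
bimodule over itself: `(a ⊗ op b) • x = a * x * b`. -/
noncomputable def regularBimodule (k : Type u) (A : Type v) [CommRing k] [Ring A] [Algebra k A] :
    ModuleCat.{v} (A ⊗[k] Aᵐᵒᵖ) :=
  letI : Module (A ⊗[k] Aᵐᵒᵖ) A := TensorProduct.Algebra.module
  ModuleCat.of (A ⊗[k] Aᵐᵒᵖ) A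

/-- The Hochschild cohomology group `HHⁱ(A) = Extⁱ(A, A)` over the enveloping algebra of `A`. -/
abbrev HH (k : Type u) (A : Type v) [CommRing k] [Ring A] [Algebra k A] (i : ℕ) : Type v :=
  CategoryTheory.Abelian.Ext.{v} (regularBimodule k A) (regularBimodule k A) i

/-! ### Path algebras -/

/-- All paths of a quiver `V`, the stationary ones included. -/
abbrev AllPaths (V : Type v) [Quiver.{w + 1} V] := Σ x y : V, Quiver.Path x y

/-- The path algebra `kQ`: the `k`-vector space with basis the set of all paths. -/
def PathAlgebra (k : Type u) (V : Type v) [Field k] [Quiver.{w + 1} V] := AllPaths V →₀ k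

namespace PathAlgebra

variable {k : Type u} {V : Type v} [Field k] [Quiver.{w + 1} V]

noncomputable instance : AddCommGroup (PathAlgebra k V) :=
  inferInstanceAs (AddCommGroup (AllPaths V →₀ k))

noncomputable instance : Module k (PathAlgebra k V) :=
  inferInstanceAs (Module k (AllPaths V →₀ k))

variable (k) in
/-- The basis element of the path algebra given by a path. -/
noncomputable def of (p : AllPaths V) : PathAlgebra k V := (Finsupp.single p 1 : AllPaths V →₀ k)

open Classical in
variable (k) in
/-- The product of two basis elements: the composition `p q` (first `p`, then `q`) if the target of
`p` is the source of `q`, and `0` otherwise. -/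
noncomputable def pathMul (p q : AllPaths V) : PathAlgebra k V :=
  if h : q.1 = p.2.1 then of k ⟨p.1, q.2.1, p.2.2.comp (q.2.2.cast h rfl)⟩ else 0

variable (k V) in
/-- The bilinear extension of `pathMul`. -/
noncomputable def mulHom : PathAlgebra k V →ₗ[k] PathAlgebra k V →ₗ[k] PathAlgebra k V :=
  Finsupp.linearCombination k fun p : AllPaths V =>
    (Finsupp.linearCombination k fun q : AllPaths V => pathMul k p q :
      (AllPaths V →₀ k) →ₗ[k] PathAlgebra k V)

noncomputable instance : Mul (PathAlgebra k V) := ⟨fun f g => mulHom k V f g⟩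

/-- The unit is the sum of the stationary paths. -/
noncomputable instance [Fintype V] : One (PathAlgebra k V) :=
  ⟨∑ x : V, of k ⟨x, x, Quiver.Path.nil⟩⟩

theorem mul_def (f g : PathAlgebra k V) : f * g = mulHom k V f g := rfl

theorem one_def [Fintype V] :
    (1 : PathAlgebra k V) = ∑ x : V, of k ⟨x, x, Quiver.Path.nil⟩ := rfl

theorem mulHom_of_of (p q : AllPaths V) : mulHom k V (of k p) (of k q) = pathMul k p q := by
  unfold mulHom of
  erw [Finsupp.linearCombination_single, one_smul, Finsupp.linearCombination_single, one_smul]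

theorem pathMul_comp {x y z : V} (p : Quiver.Path x y) (q : Quiver.Path y z) :
    pathMul k ⟨x, y, p⟩ ⟨y, z, q⟩ = of k ⟨x, z, p.comp q⟩ := by
  simp [pathMul]

theorem pathMul_of_ne {x y y' z : V} (p : Quiver.Path x y) (q : Quiver.Path y' z) (h : y' ≠ y) :
    pathMul k ⟨x, y, p⟩ ⟨y', z, q⟩ = 0 := by
  simp [pathMul, h]

theorem induction_of {P : PathAlgebra k V → Prop} (f : PathAlgebra k V) (h0 : P 0)
    (hadd : ∀ f g, P f → P g → P (f + g)) (hsmul : ∀ (c : k) (p : AllPaths V), P (c • of k p)) :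
    P f := by
  refine Finsupp.induction_linear (motive := P) f h0 hadd fun p c => ?_
  have h : (Finsupp.single p c : AllPaths V →₀ k) = c • Finsupp.single p 1 := by simp
  rw [h]
  exact hsmul c p

theorem mulHom_assoc_of (p q r : AllPaths V) :
    mulHom k V (mulHom k V (of k p) (of k q)) (of k r) =
      mulHom k V (of k p) (mulHom k V (of k q) (of k r)) := by
  obtain ⟨a, b, p⟩ := p
  obtain ⟨b', c, q⟩ := q
  obtain ⟨c', d, r⟩ := r
  rw [mulHom_of_of, mulHom_of_of]
  by_cases h : b' = b
  · subst h
    by_cases h' : c' = c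
    · subst h'
      simp only [pathMul_comp, mulHom_of_of, Quiver.Path.comp_assoc]
    · rw [pathMul_comp, pathMul_of_ne _ _ h', mulHom_of_of, pathMul_of_ne _ _ h', map_zero]
  · rw [pathMul_of_ne _ _ h, map_zero, LinearMap.zero_apply]
    by_cases h' : c' = c
    · subst h'
      rw [pathMul_comp, mulHom_of_of, pathMul_of_ne _ _ h]
    · rw [pathMul_of_ne _ _ h', map_zero]

theorem mulHom_assoc (f g h : PathAlgebra k V) :
    mulHom k V (mulHom k V f g) h = mulHom k V f (mulHom k V g h) := by
  induction f using induction_of with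
  | h0 => simp
  | hadd f f' hf hf' => simp [hf, hf']
  | hsmul a p =>
    induction g using induction_of with
    | h0 => simp
    | hadd g g' hg hg' => simp only [map_add, LinearMap.add_apply, hg, hg']
    | hsmul b q =>
      induction h using induction_of with
      | h0 => simp
      | hadd h h' hh hh' => simp only [map_add, hh, hh']
      | hsmul c r => simp only [map_smul, LinearMap.smul_apply, mulHom_assoc_of]

theorem mulHom_one_left [Fintype V] (f : PathAlgebra k V) : mulHom k V 1 f = f := by
  induction f using induction_of with
  | h0 => simp
  | hadd f f' hf hf' => simp [hf, hf']
  | hsmul a p =>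
    obtain ⟨x, y, p⟩ := p
    rw [map_smul, one_def, map_sum, LinearMap.sum_apply, Finset.sum_eq_single x]
    · rw [mulHom_of_of, pathMul_comp, Quiver.Path.nil_comp]
    · intro z _ hz
      rw [mulHom_of_of, pathMul_of_ne _ _ hz.symm]
    · simp

theorem mulHom_one_right [Fintype V] (f : PathAlgebra k V) : mulHom k V f 1 = f := by
  induction f using induction_of with
  | h0 => simp
  | hadd f f' hf hf' => simp [hf, hf']
  | hsmul a p =>
    obtain ⟨x, y, p⟩ := p
    rw [map_smul, LinearMap.smul_apply, one_def, map_sum, Finset.sum_eq_single y]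
    · rw [mulHom_of_of, pathMul_comp, Quiver.Path.comp_nil]
    · intro z _ hz
      rw [mulHom_of_of, pathMul_of_ne _ _ hz]
    · simp

noncomputable instance [Fintype V] : Ring (PathAlgebra k V) where
  __ := (inferInstance : AddCommGroup (PathAlgebra k V))
  __ := (inferInstance : Mul (PathAlgebra k V))
  __ := (inferInstance : One (PathAlgebra k V))
  left_distrib f g h := map_add (mulHom k V f) g h
  right_distrib f g h := by simp only [mul_def, map_add, LinearMap.add_apply]
  zero_mul f := by simp only [mul_def, map_zero, LinearMap.zero_apply]
  mul_zero f := by simp only [mul_def, map_zero]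
  mul_assoc := mulHom_assoc
  one_mul := mulHom_one_left
  mul_one := mulHom_one_right

noncomputable instance [Fintype V] : Algebra k (PathAlgebra k V) :=
  Algebra.ofModule
    (fun r f g => by simp only [mul_def, map_smul, LinearMap.smul_apply])
    (fun r f g => by simp only [mul_def, map_smul])

end PathAlgebra

/-! ### Admissible ideals and monomial ideals -/

section Ideals

/-- The `m`-th power of a two-sided ideal, generated by the products of `m` of its elements. -/
def idealPow {R : Type u} [Ring R] (J : TwoSidedIdeal R) (m : ℕ) : TwoSidedIdeal R :=
  TwoSidedIdeal.span {x | ∃ l : List R, l.length = m ∧ (∀ a ∈ l, a ∈ J) ∧ l.prod = x}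

variable (k : Type u) (V : Type v) [Field k] [Quiver.{w + 1} V] [Fintype V]

/-- The two-sided ideal of `kQ` generated by the arrows. -/
noncomputable def arrowIdeal : TwoSidedIdeal (PathAlgebra k V) :=
  TwoSidedIdeal.span {f | ∃ (x y : V) (α : x ⟶ y), f = PathAlgebra.of k ⟨x, y, α.toPath⟩}

variable {k V}

/-- `I` is admissible: `F ^ m ⊆ I ⊆ F ^ 2` for some `m ≥ 2`, where `F` is the arrow ideal. -/
def IsAdmissible (I : TwoSidedIdeal (PathAlgebra k V)) : Prop :=
  (∃ m : ℕ, 2 ≤ m ∧ idealPow (arrowIdeal k V) m ≤ I) ∧ I ≤ idealPow (arrowIdeal k V) 2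

/-- `I` is monomial: it is generated, as a two-sided ideal, by a set of paths. -/
def IsMonomial (I : TwoSidedIdeal (PathAlgebra k V)) : Prop :=
  ∃ S : Set (AllPaths V), I = TwoSidedIdeal.span (PathAlgebra.of k '' S)

/-- The bound quiver algebra `kQ / I`. -/
abbrev BoundQuiverAlgebra (I : TwoSidedIdeal (PathAlgebra k V)) := PathAlgebra k V ⧸ I.asIdeal

end Ideals

/-! ### The underlying graph of a quiver -/

section Graph

variable (V : Type v) [Quiver.{w + 1} V]

/-- Two distinct vertices are adjacent if there is an arrow between them, in either direction;
loops and multiplicities are forgotten. -/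
def underlyingSimpleGraph : SimpleGraph V := SimpleGraph.fromRel fun x y : V => Nonempty (x ⟶ y)

/-- The quiver is connected (and nonempty). -/
def IsConnected : Prop := (underlyingSimpleGraph V).Connected

/-- The quiver is a tree: its underlying undirected multigraph is connected and has no cycle, that
is, no loop, no two different arrows with the same pair of end points, and no cycle through three
or more vertices. -/
structure IsTree : Prop where
  no_loop : ∀ x : V, IsEmpty (x ⟶ x)
  no_multiple : Function.Injective fun α : (Σ x y : V, x ⟶ y) => s(α.1, α.2.1)
  isTree : (underlyingSimpleGraph V).IsTree

end Graph

end BoundQuiver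

/-! (b) ⇒ (c): Give each arrow a weight in `k`. Multiplying each path by its total weight is a
derivation of `kQ`; it preserves `I` because `I` is generated by paths, so it descends to `A`. If
`HH¹(A) = 0`, the induced derivation is inner, given by the class of some `c`. Since `I ⊆ F²`, the
coefficient of an arrow `α : x ⟶ y` survives in `A`, and comparing it shows that the weight of `α`
is `c_x - c_y`, where `c_x` is the coefficient of the stationary path at `x`. So every function on
arrows is a coboundary (`exists_potential_of_subsingleton_HH_one`), and testing this on indicators
of single arrows excludes loops, parallel or opposite arrows, and cycles
(`isTree_of_exists_potential`).

(c) ⇒ (a): Put `R = A ⊗ Aᵒᵖ`, so that pairs of vertices give orthogonal idempotents of `R`. The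
bimodule `A` is generated by `1`, fixed by the diagonal idempotent `e`. On a tree the kernel of `Re
→ A` is generated by one element `ω = ∑ (α ⊗ e_t - e_s ⊗ α)`, which lies in `fR` for the idempotent
`f` of pairs joined by an arrow. The kernel of `Rf → Rω` is fixed by the idempotent `ε` of pairs
joined by a path that vanishes in `A`. Paths in a tree are unique, so `εA = 0`; and `Rε = εRε`,
because a path extending a zero path is zero. Hence this second kernel has no `Ext` into `A` in any
degree, and two dimension shifts kill `HHⁿ` for `n ≥ 2`. For `n = 1`, a map `Rω → A` sends `ω` to a
combination of arrows, and extending it to `Re` amounts to finding a potential on the tree.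
`subsingleton_ext_self` isolates the homological argument. -/

namespace BoundQuiver

/-! ### Dimension shifting for `Ext` of modules -/

section Ext

universe z

open CategoryTheory CategoryTheory.Abelian

variable {R : Type z} [Ring R]

section Shift

variable {P : Type z} [AddCommGroup P] [Module R P] [Module.Projective R P]
  {M : ModuleCat.{z} R} (N : ModuleCat.{z} R) {g : P →ₗ[R] M} (hg : Function.Surjective g)

/-- The short complex `0 → ker g → P → M → 0`. -/
abbrev kerComplex (g : P →ₗ[R] M) : ShortComplex (ModuleCat.{z} R) where
  X₁ := ModuleCat.of R (LinearMap.ker g)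
  X₂ := ModuleCat.of R P
  X₃ := M
  f := ModuleCat.ofHom (LinearMap.ker g).subtype
  g := ModuleCat.ofHom g
  zero := by ext; simp

theorem kerComplex_shortExact {P : Type z} [AddCommGroup P] [Module R P] {M : ModuleCat.{z} R}
    {g : P →ₗ[R] M} (hg : Function.Surjective g) : (kerComplex g).ShortExact where
  exact := (ShortComplex.ShortExact.moduleCat_exact_iff_function_exact _).mpr
    fun _ ↦ by simp [kerComplex]
  mono_f := (ModuleCat.mono_iff_injective _).mpr (LinearMap.ker g).injective_subtype
  epi_g := (ModuleCat.epi_iff_surjective _).mpr hg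

include hg

theorem subsingleton_ext_succ (n : ℕ)
    (h : Subsingleton (Ext (ModuleCat.of R (LinearMap.ker g)) N n)) :
    Subsingleton (Ext M N (n + 1)) := by
  have hS := kerComplex_shortExact hg
  have : Projective (ModuleCat.of R P) := inferInstance
  refine subsingleton_of_forall_eq 0 fun x => ?_
  obtain ⟨y, rfl⟩ := Ext.contravariant_sequence_exact₃ hS N x
    (Ext.eq_zero_of_projective (P := ModuleCat.of R P) _) (add_comm 1 n)
  rw [Subsingleton.elim y 0, Ext.comp_zero]

/-- Since `Ext¹(P, N) = 0`, the group `Ext¹(M, N)` is the cokernel of the restriction from `Hom(P,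
N)` to `Hom(ker g, N)`. -/
theorem subsingleton_ext_one
    (h : ∀ φ : LinearMap.ker g →ₗ[R] N, ∃ ψ : P →ₗ[R] N, ∀ x : LinearMap.ker g, ψ x = φ x) :
    Subsingleton (Ext M N 1) := by
  have hS := kerComplex_shortExact hg
  have : Projective (ModuleCat.of R P) := inferInstance
  refine subsingleton_of_forall_eq 0 fun x => ?_
  obtain ⟨y, rfl⟩ := Ext.contravariant_sequence_exact₃ hS N x
    (Ext.eq_zero_of_projective (P := ModuleCat.of R P) _) (add_zero 1)
  obtain ⟨φ, rfl⟩ := Ext.homEquiv₀.symm.surjective y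
  obtain ⟨ψ, hψ⟩ := h φ.hom
  have e : φ = (kerComplex g).f ≫ ModuleCat.ofHom ψ := by
    ext x
    exact (hψ x).symm
  have e2 : Ext.homEquiv₀.symm φ =
      (Ext.mk₀ (kerComplex g).f).comp (Ext.mk₀ (ModuleCat.ofHom ψ)) (zero_add 0) := by
    rw [Ext.mk₀_comp_mk₀, ← e]
    rfl
  rw [e2]
  exact hS.extClass_comp_assoc _

omit [Module.Projective R P] in
theorem exists_extension_of_subsingleton_ext_one (h : Subsingleton (Ext M N 1))
    (φ : LinearMap.ker g →ₗ[R] N) : ∃ ψ : P →ₗ[R] N, ∀ x : LinearMap.ker g, ψ x = φ x := by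
  have hS := kerComplex_shortExact hg
  obtain ⟨y, hy⟩ := Ext.contravariant_sequence_exact₁ hS N
    (Ext.mk₀ (ModuleCat.ofHom φ)) (add_zero 1) (Subsingleton.elim _ _)
  obtain ⟨ψ, rfl⟩ := Ext.homEquiv₀.symm.surjective y
  refine ⟨ψ.hom, fun x => ?_⟩
  have e : (kerComplex g).f ≫ ψ = ModuleCat.ofHom φ := by
    apply Ext.homEquiv₀.symm.injective
    refine Eq.trans ?_ hy
    exact (Ext.mk₀_comp_mk₀ _ _).symm
  exact congrArg (fun t => t.hom x) e

end Shift

theorem projective_span_idempotent {e : R} (he : e * e = e) :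
    Module.Projective R (Submodule.span R {e}) := by
  refine Module.Projective.of_split (M := R) (Submodule.span R {e}).subtype
    (LinearMap.toSpanSingleton R (Submodule.span R {e}) ⟨e, Submodule.mem_span_singleton_self e⟩) ?_
  ext ⟨x, hx⟩
  obtain ⟨r, rfl⟩ := Submodule.mem_span_singleton.1 hx
  simp [mul_assoc, he]

/-- If `R ε = ε R ε`, then modules on which `ε` acts as the identity have no extensions by modules
killed by `ε`. -/
theorem subsingleton_ext_of_support {ε : R} (hε : ∀ r : R, ε * (r * ε) = r * ε)
    (N : ModuleCat.{z} R) (hN : ∀ x : N, ε • x = 0) (n : ℕ) (M : ModuleCat.{z} R)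
    (hM : ∀ x : M, ε • x = x) : Subsingleton (Ext M N n) := by
  classical
  have hεε : ε * ε = ε := by simpa using hε 1
  induction n generalizing M with
  | zero =>
    have : Subsingleton (M ⟶ N) := by
      refine subsingleton_of_forall_eq 0 fun φ => ?_
      ext x
      have := φ.hom.map_smul ε x
      rw [hM, hN] at this
      exact this
    exact Ext.homEquiv₀.subsingleton
  | succ n ih =>
    have := projective_span_idempotent hεε
    have : Module.Projective R (M →₀ Submodule.span R {ε}) :=
      Module.Projective.of_equiv (finsuppLequivDFinsupp (M := Submodule.span R {ε}) R).symm
    -- One copy of `Rε` for each `x` in `M`, with `ε` sent to `ε • x = x`. The kernel lies in a sum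
    -- of copies of `Rε`, on which `ε` is the identity by `hε`, so the induction hypothesis applies
    -- to it.
    let q : (M →₀ Submodule.span R {ε}) →ₗ[R] M :=
      Finsupp.lsum ℕ fun x => (LinearMap.toSpanSingleton R M x).comp (Submodule.subtype _)
    have hq : Function.Surjective q := fun x =>
      ⟨Finsupp.single x ⟨ε, Submodule.mem_span_singleton_self ε⟩, by simp [q, hM]⟩
    refine subsingleton_ext_succ N hq n (ih _ ?_)
    rintro ⟨x, hx⟩
    refine Subtype.ext ?_
    ext y
    obtain ⟨r, hr⟩ := Submodule.mem_span_singleton.1 (x y).2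
    simp only [SetLike.mk_smul_mk, Finsupp.smul_apply, Submodule.coe_smul, ← hr, smul_eq_mul, hε]

/-- A cyclic module with a two-term projective presentation whose kernel is supported on `ε`, where
`ε` kills the module, has no higher self-extensions. -/
theorem subsingleton_ext_self (M : ModuleCat.{z} R) (u : M) {e f ε ω : R}
    (hu : ∀ x : M, ∃ r : R, r • u = x) (he : e * e = e) (heu : e • u = u)
    (hf : f * f = f) (hfω : f * ω = ω) (hωe : ω * e = ω) (hωu : ω • u = 0)
    (hker : ∀ r : R, r • u = 0 → ∃ s : R, r * e = s * ω)
    (hker₂ : ∀ r : R, r * f = r → r * ω = 0 → ε * r = r)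
    (hε : ∀ r : R, ε * (r * ε) = r * ε) (hεM : ∀ x : M, ε • x = 0)
    (hsolve : ∀ x : M, f • x = x → ∃ y : M, ω • y = x) {n : ℕ} (hn : 0 < n) :
    Subsingleton (Ext M M n) := by
  have := projective_span_idempotent he
  have := projective_span_idempotent hf
  let g : Submodule.span R {e} →ₗ[R] M :=
    (LinearMap.toSpanSingleton R M u).comp (Submodule.subtype _)
  have hgval (x : Submodule.span R {e}) : g x = (x : R) • u := rfl
  have hg : Function.Surjective g := fun x => by
    obtain ⟨r, rfl⟩ := hu x
    refine ⟨⟨r * e, Submodule.mem_span_singleton.2 ⟨r, rfl⟩⟩, ?_⟩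
    rw [hgval, mul_smul, heu]
  let ω' : LinearMap.ker g := ⟨⟨ω, Submodule.mem_span_singleton.2 ⟨ω, hωe⟩⟩, hωu⟩
  have hω' (x : LinearMap.ker g) : ∃ s : R, s • ω' = x := by
    obtain ⟨⟨x, hx⟩, hxu⟩ := x
    obtain ⟨r, rfl⟩ := Submodule.mem_span_singleton.1 hx
    obtain ⟨s, hs⟩ : ∃ s, r * e * e = s * ω := hker _ hxu
    rw [mul_assoc, he] at hs
    refine ⟨s, Subtype.ext (Subtype.ext ?_)⟩
    exact hs.symm
  obtain _ | _ | n := n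
  · exact absurd hn (lt_irrefl 0)
  -- A map on `ker g = Rω` is determined by its value at `ω`, which is fixed by `f`. Acting on `y`
  -- extends it as soon as `ω • y` is that value.
  · refine subsingleton_ext_one M hg fun φ => ?_
    obtain ⟨y, hy⟩ := hsolve (φ ω') (by
      rw [← map_smul]
      exact congrArg φ (Subtype.ext (Subtype.ext hfω)))
    refine ⟨(LinearMap.toSpanSingleton R M y).comp (Submodule.subtype _), fun x => ?_⟩
    obtain ⟨s, rfl⟩ := hω' x
    rw [map_smul, ← hy, ← mul_smul]
    rfl
  · refine subsingleton_ext_succ M hg _ ?_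
    let d : Submodule.span R {f} →ₗ[R] LinearMap.ker g :=
      (LinearMap.toSpanSingleton R _ ω').comp (Submodule.subtype _)
    have hd : Function.Surjective d := fun x => by
      obtain ⟨s, rfl⟩ := hω' x
      refine ⟨⟨s * f, Submodule.mem_span_singleton.2 ⟨s, rfl⟩⟩, Subtype.ext (Subtype.ext ?_)⟩
      change s * f * ω = s * ω
      rw [mul_assoc, hfω]
    -- After both shifts the degree may be `0`, so the vanishing of `Hom` out of the second kernel
    -- is needed too.
    refine subsingleton_ext_succ (M := ModuleCat.of R (LinearMap.ker g)) M hd n ?_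
    refine subsingleton_ext_of_support hε M hεM n _ ?_
    rintro ⟨⟨x, hx⟩, hxd⟩
    refine Subtype.ext (Subtype.ext (hker₂ x ?_ ?_))
    · obtain ⟨r, rfl⟩ := Submodule.mem_span_singleton.1 hx
      simp [mul_assoc, hf]
    · exact congrArg (fun t : LinearMap.ker g => ((t : Submodule.span R {e}) : R)) hxd

end Ext

end BoundQuiver

namespace BoundQuiver

universe u v w

/-! ### Inner derivations and the first Hochschild cohomology group -/

section Derivations

variable {k : Type u} {A : Type v} [CommRing k] [Ring A] [Algebra k A]

variable (k A) in
/-- The identification of an algebra with its regular bimodule. -/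
noncomputable def toRegular : A ≃+ regularBimodule k A := AddEquiv.refl A

theorem tmul_smul_toRegular (a b x : A) :
    (a ⊗ₜ[k] MulOpposite.op b : A ⊗[k] Aᵐᵒᵖ) • toRegular k A x = toRegular k A (a * (x * b)) := rfl

/-- If `HH¹(A) = 0` then every `k`-linear derivation of `A` is inner. -/
theorem exists_inner_of_subsingleton_HH_one (h : Subsingleton (HH k A 1)) (D : A →ₗ[k] A)
    (hD : ∀ a b, D (a * b) = D a * b + a * D b) : ∃ c : A, ∀ a, D a = c * a - a * c := by
  have hD1 : D 1 = 0 := by simpa using hD 1 1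
  let g : (A ⊗[k] Aᵐᵒᵖ) →ₗ[A ⊗[k] Aᵐᵒᵖ] regularBimodule k A :=
    LinearMap.toSpanSingleton _ (regularBimodule k A) (toRegular k A 1)
  have hgt (a b : A) : g (a ⊗ₜ MulOpposite.op b) = toRegular k A (a * b) :=
    (tmul_smul_toRegular a b 1).trans (by rw [one_mul])
  have hg : Function.Surjective g := fun x => by
    obtain ⟨x, rfl⟩ := (toRegular k A).surjective x
    exact ⟨x ⊗ₜ MulOpposite.op 1, by rw [hgt, mul_one]⟩
  -- The map `a ⊗ b ↦ a * D b`. By the Leibniz rule its failure to be a bimodule map is proportional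
  -- to `g r`, so it is linear on `ker g`.
  let T : A ⊗[k] Aᵐᵒᵖ →ₗ[k] A :=
    LinearMap.mul' k A ∘ₗ
      TensorProduct.map LinearMap.id (D ∘ₗ (MulOpposite.opLinearEquiv k).symm.toLinearMap)
  have hT (a b : A) : T (a ⊗ₜ MulOpposite.op b) = a * D b := rfl
  have hTmul (a b : A) (r : A ⊗[k] Aᵐᵒᵖ) :
      T (a ⊗ₜ MulOpposite.op b * r) =
        a * (T r * b) + a * (toRegular k A).symm (g r) * D b := by
    induction r using TensorProduct.induction_on with
    | zero => simp
    | add r s hr hs =>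
      rw [mul_add, map_add, hr, hs, map_add, map_add, map_add]
      noncomm_ring
    | tmul c d =>
      obtain ⟨d, rfl⟩ := MulOpposite.op_surjective d
      rw [Algebra.TensorProduct.tmul_mul_tmul, ← MulOpposite.op_mul, hT, hT, hD, hgt,
        AddEquiv.symm_apply_apply]
      noncomm_ring
  let φ : LinearMap.ker g →ₗ[A ⊗[k] Aᵐᵒᵖ] regularBimodule k A :=
    { toFun := fun r => toRegular k A (T r)
      map_add' := fun r s => by rw [Submodule.coe_add, map_add, map_add]
      map_smul' := by
        rintro s ⟨r, hr⟩
        rw [RingHom.id_apply, Submodule.coe_smul, smul_eq_mul]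
        induction s using TensorProduct.induction_on with
        | zero =>
          rw [zero_mul, map_zero, map_zero]
          exact (zero_smul (A ⊗[k] Aᵐᵒᵖ) (toRegular k A (T r))).symm
        | add s t hs ht => rw [add_mul, map_add, map_add, hs, ht, add_smul]
        | tmul a b =>
          obtain ⟨b, rfl⟩ := MulOpposite.op_surjective b
          rw [hTmul, LinearMap.mem_ker.1 hr, map_zero, mul_zero, zero_mul, add_zero,
            tmul_smul_toRegular] }
  obtain ⟨ψ, hψ⟩ := exists_extension_of_subsingleton_ext_one _ hg h φ
  obtain ⟨c, hc⟩ := (toRegular k A).surjective (ψ 1)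
  have hψt (a b : A) : ψ (a ⊗ₜ MulOpposite.op b) = toRegular k A (a * (c * b)) := by
    rw [← tmul_smul_toRegular, hc, ← map_smul, smul_eq_mul, mul_one]
  refine ⟨c, fun a => ?_⟩
  -- On this element `T` gives `D a`, because `D 1 = 0`, and the extension `ψ` gives `c * a - a *
  -- c`.
  have hmem : (1 ⊗ₜ MulOpposite.op a - a ⊗ₜ MulOpposite.op 1 : A ⊗[k] Aᵐᵒᵖ) ∈
      LinearMap.ker g := by
    rw [LinearMap.mem_ker, map_sub, hgt, hgt, one_mul, mul_one, sub_self]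
  have := hψ ⟨_, hmem⟩
  rw [map_sub, hψt, hψt, ← map_sub] at this
  have := (toRegular k A).injective this
  rw [map_sub, hT, hT, hD1] at this
  simpa using this.symm

end Derivations

/-! ### Weights of paths -/

section Weight

variable {V : Type v} [Quiver.{w + 1} V] {G : Type*} [AddCommGroup G]

/-- The sum of the values of a function on arrows along a path. -/
def pathWeight (φ : ∀ ⦃x y : V⦄, (x ⟶ y) → G) {x : V} : ∀ {y : V}, Quiver.Path x y → G
  | _, .nil => 0
  | _, .cons p α => pathWeight φ p + φ α

variable (φ : ∀ ⦃x y : V⦄, (x ⟶ y) → G)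

theorem pathWeight_comp {x y z : V} (p : Quiver.Path x y) (q : Quiver.Path y z) :
    pathWeight φ (p.comp q) = pathWeight φ p + pathWeight φ q := by
  induction q with
  | nil => simp [pathWeight]
  | cons q α ih => simp [pathWeight, ih, add_assoc]

theorem pathWeight_toPath {x y : V} (α : x ⟶ y) : pathWeight φ α.toPath = φ α := by
  simp [Quiver.Hom.toPath, pathWeight]

theorem pathWeight_eq_sub {a : V → G} (ha : ∀ ⦃x y : V⦄ (α : x ⟶ y), φ α = a y - a x) {x y : V}
    (p : Quiver.Path x y) : pathWeight φ p = a y - a x := by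
  induction p with
  | nil => simp [pathWeight]
  | cons p α ih => rw [pathWeight, ih, ha]; abel

end Weight

/-! ### Trees -/

section Tree

variable {V : Type v} [Quiver.{w + 1} V]

/-- All arrows of a quiver. -/
abbrev Arrows (V : Type v) [Quiver.{w + 1} V] := Σ x y : V, x ⟶ y

open Classical in
/-- The indicator function of an arrow. -/
noncomputable def arrowIndicator (G : Type*) [AddCommGroup G] [One G] (β : Arrows V) ⦃x y : V⦄
    (α : x ⟶ y) : G :=
  if (⟨x, y, α⟩ : Arrows V) = β then 1 else 0

variable (hT : IsTree V)
include hT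

/-- The edge under `β` is a bridge. The potential is the indicator of the component of the target
once that edge is deleted; every other arrow stays inside one component, since no other arrow lies
over the deleted edge. -/
theorem IsTree.exists_potential_arrowIndicator (G : Type*) [AddCommGroup G] [One G]
    (β : Arrows V) : ∃ a : V → G, ∀ ⦃x y : V⦄ (α : x ⟶ y),
      arrowIndicator G β α = a y - a x := by
  classical
  obtain ⟨s, t, β⟩ := β
  have hadj {x y : V} (α : x ⟶ y) : (underlyingSimpleGraph V).Adj x y := by
    rw [underlyingSimpleGraph, SimpleGraph.fromRel_adj]
    exact ⟨fun h => by subst h; exact (hT.no_loop x).false α, Or.inl ⟨α⟩⟩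
  have hbr := SimpleGraph.isAcyclic_iff_forall_isBridge.1 hT.isTree.isAcyclic
    ((SimpleGraph.mem_edgeSet _).2 (hadj β))
  rw [SimpleGraph.isBridge_iff] at hbr
  set H := (underlyingSimpleGraph V).deleteEdges {s(s, t)} with hH
  refine ⟨fun z => if H.Reachable t z then 1 else 0, fun x y α => ?_⟩
  by_cases h : (⟨x, y, α⟩ : Arrows V) = ⟨s, t, β⟩
  · cases h
    have h1 : ¬ H.Reachable t s := fun h => hbr h.symm
    simp [arrowIndicator, h1]
  · have hxy : H.Adj x y := by
      rw [hH, SimpleGraph.deleteEdges_adj]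
      exact ⟨hadj α, fun he => h (hT.no_multiple he)⟩
    have : H.Reachable t x ↔ H.Reachable t y :=
      ⟨fun h => h.trans hxy.reachable, fun h => h.trans hxy.symm.reachable⟩
    rw [arrowIndicator, if_neg h]
    simp [this]

theorem IsTree.exists_potential {R : Type*} [Ring R] [Finite (Arrows V)]
    (φ : ∀ ⦃x y : V⦄, (x ⟶ y) → R) :
    ∃ a : V → R, ∀ ⦃x y : V⦄ (α : x ⟶ y), φ α = a y - a x := by
  classical
  have := Fintype.ofFinite (Arrows V)
  choose a ha using hT.exists_potential_arrowIndicator R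
  refine ⟨fun z => ∑ β : Arrows V, φ β.2.2 * a β z, fun x y α => ?_⟩
  rw [← Finset.sum_sub_distrib, Finset.sum_eq_single (⟨x, y, α⟩ : Arrows V)]
  · rw [← mul_sub, ← ha _ α]
    simp [arrowIndicator]
  · intro β _ hβ
    rw [← mul_sub, ← ha, arrowIndicator, if_neg hβ.symm, mul_zero]
  · simp

-- Such a path traverses `β`; what follows the last occurrence of `β` is the required path.
omit hT in
theorem nonempty_path_of_pathWeight_ne_zero {β : Arrows V} {x y : V} (p : Quiver.Path x y)
    (hp : pathWeight (arrowIndicator ℤ β) p ≠ 0) : Nonempty (Quiver.Path β.2.1 y) := by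
  induction p with
  | nil => exact absurd rfl hp
  | cons p α ih =>
    by_cases h : (⟨_, _, α⟩ : Arrows V) = β
    · subst h
      exact ⟨.nil⟩
    · rw [pathWeight, arrowIndicator, if_neg h, add_zero] at hp
      obtain ⟨q⟩ := ih hp
      exact ⟨q.cons α⟩

/-- Two vertices of a tree are joined by at most one path. -/
theorem IsTree.path_unique [Finite (Arrows V)] {x y : V} (p q : Quiver.Path x y) : p = q := by
  -- A height function rising by one along each arrow rules out oriented cycles.
  obtain ⟨ht, hht⟩ := hT.exists_potential (R := ℤ) fun _ _ _ => 1
  have hclosed {z z' : V} (r : Quiver.Path z z') (γ : z' ⟶ z) : False := by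
    have hlen {a b : V} (r : Quiver.Path a b) : 0 ≤ ht b - ht a := by
      induction r with
      | nil => simp
      | cons r α ih => have := hht α; omega
    have h1 := hlen r
    have h2 := hht γ
    omega
  induction p with
  | nil =>
    cases q with
    | nil => rfl
    | cons q β => exact (hclosed q β).elim
  | @cons z y p α ih =>
    cases q with
    | nil => exact (hclosed p α).elim
    | @cons z' _ q β =>
      by_cases h : (⟨z, y, α⟩ : Arrows V) = ⟨z', y, β⟩
      · cases h
        rw [ih q]
      -- The number of passages through `α` depends only on the end points, so the second path also
      -- uses `α`, and before its last arrow `β`. The part after `α`, closed up by `β`, is an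
      -- oriented cycle.
      · obtain ⟨a, ha⟩ := hT.exists_potential_arrowIndicator ℤ ⟨z, y, α⟩
        have hnn {b c : V} (r : Quiver.Path b c) :
            0 ≤ pathWeight (arrowIndicator ℤ (⟨z, y, α⟩ : Arrows V)) r := by
          induction r with
          | nil => simp [pathWeight]
          | cons r γ ih =>
            have : 0 ≤ arrowIndicator ℤ (⟨z, y, α⟩ : Arrows V) γ := by
              unfold arrowIndicator; split <;> simp
            simpa [pathWeight] using add_nonneg ih this
        have e1 := pathWeight_eq_sub _ ha (p.cons α)
        rw [← pathWeight_eq_sub _ ha (q.cons β)] at e1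
        have h1 : arrowIndicator ℤ (⟨z, y, α⟩ : Arrows V) α = 1 := by simp [arrowIndicator]
        have h2 : arrowIndicator ℤ (⟨z, y, α⟩ : Arrows V) β = 0 := by
          rw [arrowIndicator, if_neg fun h' => h h'.symm]
        rw [pathWeight, pathWeight, h1, h2] at e1
        have := hnn p
        obtain ⟨r⟩ := nonempty_path_of_pathWeight_ne_zero q (β := ⟨z, y, α⟩) (by omega)
        exact (hclosed r β).elim

end Tree

end BoundQuiver

namespace BoundQuiver

universe u v w

/-! ### Coefficients and diagonal derivations of path algebras -/

namespace PathAlgebra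

variable {k : Type u} {V : Type v} [Field k] [Quiver.{w + 1} V]

variable (k) in
/-- The coefficient of a path. -/
noncomputable def coeff (r : AllPaths V) : PathAlgebra k V →ₗ[k] k :=
  (Finsupp.lapply r : (AllPaths V →₀ k) →ₗ[k] k)

open Classical in
theorem coeff_of (r p : AllPaths V) : coeff k r (of k p) = if p = r then 1 else 0 :=
  Finsupp.single_apply

theorem bilin_ext {M : Type*} [AddCommGroup M] [Module k M]
    {B B' : PathAlgebra k V →ₗ[k] PathAlgebra k V →ₗ[k] M}
    (h : ∀ p q, B (of k p) (of k q) = B' (of k p) (of k q)) : B = B' := by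
  ext f g
  induction f using induction_of with
  | h0 => simp
  | hadd f f' hf hf' => simp [hf, hf']
  | hsmul a p =>
    induction g using induction_of with
    | h0 => simp
    | hadd g g' hg hg' => rw [map_add, map_add, hg, hg']
    | hsmul b q => simp [h]

/-- A composite of paths is stationary only if both factors are. -/
theorem coeff_nil_mulHom (z : V) (f g : PathAlgebra k V) :
    coeff k ⟨z, z, .nil⟩ (mulHom k V f g) = coeff k ⟨z, z, .nil⟩ f * coeff k ⟨z, z, .nil⟩ g := by
  classical
  suffices h : (mulHom k V).compr₂ (coeff k ⟨z, z, .nil⟩) =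
      (LinearMap.mul k k).compl₁₂ (coeff k ⟨z, z, .nil⟩) (coeff k ⟨z, z, .nil⟩) from
    LinearMap.congr_fun₂ h f g
  refine bilin_ext ?_
  rintro ⟨a, b, p⟩ ⟨b', c, q⟩
  simp only [LinearMap.compr₂_apply, LinearMap.compl₁₂_apply, LinearMap.mul_apply', mulHom_of_of]
  by_cases hb : b' = b
  · subst hb
    rw [pathMul_comp]
    simp only [coeff_of]
    by_cases h : p.length = 0 ∧ q.length = 0
    · obtain ⟨hp, hq⟩ := h
      cases p with
      | cons _ _ => simp at hp
      | nil =>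
        cases q with
        | cons _ _ => simp at hq
        | nil => simp
    · rw [if_neg, ite_zero_mul_ite_zero, if_neg]
      · rintro ⟨h1, h2⟩
        exact h ⟨congrArg (fun t : AllPaths V => t.2.2.length) h1,
          congrArg (fun t : AllPaths V => t.2.2.length) h2⟩
      · intro h'
        have := congrArg (fun t : AllPaths V => t.2.2.length) h'
        simp only [Quiver.Path.length_comp, Quiver.Path.length_nil] at this
        omega
  · rw [pathMul_of_ne _ _ hb, map_zero, coeff_of, coeff_of, ite_zero_mul_ite_zero, if_neg]
    rintro ⟨h1, h2⟩
    exact hb ((congrArg (fun t : AllPaths V => t.1) h2).trans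
      (congrArg (fun t : AllPaths V => t.2.1) h1).symm)

/-- An arrow factors only trivially, with a stationary path at its source or at its target. -/
theorem coeff_arrow_mulHom {x y : V} (α : x ⟶ y) (f g : PathAlgebra k V) :
    coeff k ⟨x, y, α.toPath⟩ (mulHom k V f g) =
      coeff k ⟨x, x, .nil⟩ f * coeff k ⟨x, y, α.toPath⟩ g +
        coeff k ⟨x, y, α.toPath⟩ f * coeff k ⟨y, y, .nil⟩ g := by
  classical
  suffices h : (mulHom k V).compr₂ (coeff k ⟨x, y, α.toPath⟩) =
      (LinearMap.mul k k).compl₁₂ (coeff k ⟨x, x, .nil⟩) (coeff k ⟨x, y, α.toPath⟩) +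
      (LinearMap.mul k k).compl₁₂ (coeff k ⟨x, y, α.toPath⟩) (coeff k ⟨y, y, .nil⟩) from
    LinearMap.congr_fun₂ h f g
  refine bilin_ext ?_
  have hlen {r s : AllPaths V} (h : r = s) : r.2.2.length = s.2.2.length :=
    congrArg (fun t : AllPaths V => t.2.2.length) h
  rintro ⟨a, b, p⟩ ⟨b', c, q⟩
  simp only [LinearMap.compr₂_apply, LinearMap.compl₁₂_apply, LinearMap.mul_apply',
    LinearMap.add_apply, mulHom_of_of]
  by_cases hb : b' = b
  · subst hb
    rw [pathMul_comp]
    simp only [coeff_of]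
    cases p with
    | nil =>
      have h1 : (⟨a, a, .nil⟩ : AllPaths V) ≠ ⟨x, y, α.toPath⟩ := fun h => by
        simpa using hlen h
      rw [if_neg h1, zero_mul, add_zero, Quiver.Path.nil_comp]
      by_cases h : (⟨a, c, q⟩ : AllPaths V) = ⟨x, y, α.toPath⟩
      · have hx : a = x := congrArg (fun t : AllPaths V => t.1) h
        subst hx
        simp
      · simp [h]
    | cons p β =>
      have h1 : (⟨a, b', p.cons β⟩ : AllPaths V) ≠ ⟨x, x, .nil⟩ := fun h => by
        simpa using hlen h
      rw [if_neg h1, zero_mul, zero_add]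
      cases q with
      | nil =>
        rw [Quiver.Path.comp_nil]
        by_cases h : (⟨a, b', p.cons β⟩ : AllPaths V) = ⟨x, y, α.toPath⟩
        · have hy : b' = y := congrArg (fun t : AllPaths V => t.2.1) h
          subst hy
          simp
        · simp [h]
      | cons q γ =>
        rw [if_neg fun h => ?_, if_neg (c := _ = (⟨y, y, .nil⟩ : AllPaths V)) fun h => ?_,
          mul_zero]
        · have := hlen h
          simp at this
        · have := hlen h
          simp only [Quiver.Path.length_comp, Quiver.Path.length_cons, Quiver.Hom.toPath,
            Quiver.Path.length_nil] at this
          omega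
  · rw [pathMul_of_ne _ _ hb, map_zero]
    simp only [coeff_of]
    rw [ite_zero_mul_ite_zero, ite_zero_mul_ite_zero, if_neg, if_neg, add_zero]
    all_goals
      rintro ⟨h1, h2⟩
      exact hb ((congrArg (fun t : AllPaths V => t.1) h2).trans
        (congrArg (fun t : AllPaths V => t.2.1) h1).symm)

variable (k) in
/-- The derivation of the path algebra multiplying every path by its weight. -/
noncomputable def weightDerivation (φ : ∀ ⦃x y : V⦄, (x ⟶ y) → k) :
    PathAlgebra k V →ₗ[k] PathAlgebra k V :=
  (Finsupp.linearCombination k fun p : AllPaths V => pathWeight φ p.2.2 • of k p :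
    (AllPaths V →₀ k) →ₗ[k] PathAlgebra k V)

theorem weightDerivation_of (φ : ∀ ⦃x y : V⦄, (x ⟶ y) → k) (p : AllPaths V) :
    weightDerivation k φ (of k p) = pathWeight φ p.2.2 • of k p := by
  unfold weightDerivation of
  erw [Finsupp.linearCombination_single, one_smul]

theorem weightDerivation_mulHom (φ : ∀ ⦃x y : V⦄, (x ⟶ y) → k) (f g : PathAlgebra k V) :
    weightDerivation k φ (mulHom k V f g) =
      mulHom k V (weightDerivation k φ f) g + mulHom k V f (weightDerivation k φ g) := by
  suffices h : (mulHom k V).compr₂ (weightDerivation k φ) =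
      (mulHom k V).compl₁₂ (weightDerivation k φ) LinearMap.id +
      (mulHom k V).compl₁₂ LinearMap.id (weightDerivation k φ) from
    LinearMap.congr_fun₂ h f g
  refine bilin_ext ?_
  rintro ⟨a, b, p⟩ ⟨b', c, q⟩
  simp only [LinearMap.compr₂_apply, LinearMap.compl₁₂_apply, LinearMap.add_apply,
    LinearMap.id_apply, mulHom_of_of, weightDerivation_of, map_smul, LinearMap.smul_apply]
  by_cases hb : b' = b
  · subst hb
    rw [pathMul_comp, weightDerivation_of, pathWeight_comp, add_smul]
  · simp [pathMul_of_ne _ _ hb]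

end PathAlgebra

/-! ### Vanishing of the first cohomology group forces a tree -/

section OneToTree

variable {k : Type u} {V : Type v} [Field k] [Quiver.{w + 1} V] [Fintype V]

open PathAlgebra

theorem coeff_nil_eq_zero_of_mem_arrowIdeal {f : PathAlgebra k V} (hf : f ∈ arrowIdeal k V)
    (z : V) : coeff k ⟨z, z, .nil⟩ f = 0 := by
  classical
  induction hf using TwoSidedIdeal.span_induction with
  | mem f hf =>
    obtain ⟨x, y, α, rfl⟩ := hf
    rw [coeff_of, if_neg]
    intro h
    simpa using congrArg (fun t : AllPaths V => t.2.2.length) h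
  | zero => exact map_zero _
  | add f g _ _ hf hg => rw [map_add, hf, hg, add_zero]
  | neg f _ hf => rw [map_neg, hf, neg_zero]
  | left_absorb a f _ hf => rw [mul_def, coeff_nil_mulHom, hf, mul_zero]
  | right_absorb a f _ hf => rw [mul_def, coeff_nil_mulHom, hf, zero_mul]

theorem coeff_eq_zero_of_mem_arrowIdeal_sq {f : PathAlgebra k V}
    (hf : f ∈ idealPow (arrowIdeal k V) 2) :
    (∀ z, coeff k ⟨z, z, .nil⟩ f = 0) ∧
      ∀ ⦃x y : V⦄ (α : x ⟶ y), coeff k ⟨x, y, α.toPath⟩ f = 0 := by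
  induction hf using TwoSidedIdeal.span_induction with
  | mem f hf =>
    obtain ⟨l, hl, hmem, rfl⟩ := hf
    obtain ⟨a, b, rfl⟩ := List.length_eq_two.1 hl
    have ha := coeff_nil_eq_zero_of_mem_arrowIdeal (hmem a (by simp))
    have hb := coeff_nil_eq_zero_of_mem_arrowIdeal (hmem b (by simp))
    rw [List.prod_cons, List.prod_singleton, mul_def]
    exact ⟨fun z => by rw [coeff_nil_mulHom, ha, zero_mul],
      fun x y α => by rw [coeff_arrow_mulHom, ha, hb, zero_mul, mul_zero, add_zero]⟩
  | zero => exact ⟨fun _ => map_zero _, fun _ _ _ => map_zero _⟩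
  | add f g _ _ hf hg =>
    exact ⟨fun z => by rw [map_add, hf.1, hg.1, add_zero],
      fun x y α => by rw [map_add, hf.2, hg.2, add_zero]⟩
  | neg f _ hf =>
    exact ⟨fun z => by rw [map_neg, hf.1, neg_zero], fun x y α => by rw [map_neg, hf.2, neg_zero]⟩
  | left_absorb a f _ hf =>
    exact ⟨fun z => by rw [mul_def, coeff_nil_mulHom, hf.1, mul_zero],
      fun x y α => by rw [mul_def, coeff_arrow_mulHom, hf.1, hf.2, mul_zero, mul_zero, add_zero]⟩
  | right_absorb a f _ hf =>
    exact ⟨fun z => by rw [mul_def, coeff_nil_mulHom, hf.1, zero_mul],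
      fun x y α => by rw [mul_def, coeff_arrow_mulHom, hf.1, hf.2, zero_mul, zero_mul, add_zero]⟩

/-- The generating paths are eigenvectors, and the Leibniz rule carries invariance to the ideal they
generate. -/
theorem weightDerivation_mem {I : TwoSidedIdeal (PathAlgebra k V)} (hI : IsMonomial I)
    (φ : ∀ ⦃x y : V⦄, (x ⟶ y) → k) {f : PathAlgebra k V} (hf : f ∈ I) :
    weightDerivation k φ f ∈ I := by
  obtain ⟨S, rfl⟩ := hI
  induction hf using TwoSidedIdeal.span_induction with
  | mem f hf =>
    obtain ⟨p, hp, rfl⟩ := hf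
    rw [weightDerivation_of, ← one_mul (of k p), ← smul_mul_assoc]
    exact TwoSidedIdeal.mul_mem_left _ _ _ (TwoSidedIdeal.subset_span ⟨p, hp, rfl⟩)
  | zero => rw [map_zero]; exact zero_mem _
  | add f g _ _ hf hg => rw [map_add]; exact add_mem hf hg
  | neg f _ hf => rw [map_neg]; exact neg_mem hf
  | left_absorb a f h hf =>
    rw [mul_def, weightDerivation_mulHom]
    exact add_mem (TwoSidedIdeal.mul_mem_left _ _ _ h) (TwoSidedIdeal.mul_mem_left _ _ _ hf)
  | right_absorb a f h hf =>
    rw [mul_def, weightDerivation_mulHom]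
    exact add_mem (TwoSidedIdeal.mul_mem_right _ _ _ hf) (TwoSidedIdeal.mul_mem_right _ _ _ h)

/-- If `HH¹` of a monomial algebra vanishes, every function on arrows is a coboundary. -/
theorem exists_potential_of_subsingleton_HH_one {I : TwoSidedIdeal (PathAlgebra k V)}
    (hI : IsAdmissible I) (hmon : IsMonomial I)
    (h : Subsingleton (HH k (BoundQuiverAlgebra I) 1)) (φ : ∀ ⦃x y : V⦄, (x ⟶ y) → k) :
    ∃ a : V → k, ∀ ⦃x y : V⦄ (α : x ⟶ y), φ α = a x - a y := by
  let π : PathAlgebra k V →ₐ[k] BoundQuiverAlgebra I := Ideal.Quotient.mkₐ k I.asIdeal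
  have hπ : Function.Surjective π := Ideal.Quotient.mkₐ_surjective k _
  have hπ0 {f : PathAlgebra k V} : π f = 0 ↔ f ∈ I :=
    Ideal.Quotient.eq_zero_iff_mem.trans TwoSidedIdeal.mem_asIdeal
  obtain ⟨σ, hσ⟩ := π.toLinearMap.exists_rightInverse_of_surjective
    (LinearMap.range_eq_top.2 hπ)
  let D := π.toLinearMap ∘ₗ weightDerivation k φ ∘ₗ σ
  have hD (f : PathAlgebra k V) : D (π f) = π (weightDerivation k φ f) := by
    rw [← sub_eq_zero]
    change π (weightDerivation k φ (σ (π f))) - _ = 0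
    rw [← map_sub, ← map_sub, hπ0]
    refine weightDerivation_mem hmon φ (hπ0.1 ?_)
    rw [map_sub, sub_eq_zero]
    exact LinearMap.congr_fun hσ (π f)
  obtain ⟨c, hc⟩ := exists_inner_of_subsingleton_HH_one h D fun a b => by
    obtain ⟨f, rfl⟩ := hπ a
    obtain ⟨g, rfl⟩ := hπ b
    rw [← map_mul, hD, hD, hD, mul_def, weightDerivation_mulHom, map_add, ← mul_def, ← mul_def,
      map_mul, map_mul]
  obtain ⟨c, rfl⟩ := hπ c
  refine ⟨fun z => coeff k ⟨z, z, .nil⟩ c, fun x y α => ?_⟩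
  have := hc (π (of k ⟨x, y, α.toPath⟩))
  rw [hD, weightDerivation_of, pathWeight_toPath, ← map_mul, ← map_mul, ← map_sub, ← sub_eq_zero,
    ← map_sub, hπ0] at this
  -- The identity for the inner derivation holds modulo `I ⊆ F²`, hence exactly in the coefficient
  -- of `α`.
  have := (coeff_eq_zero_of_mem_arrowIdeal_sq (hI.2 this)).2 α
  classical
  have h1 (z : V) : (⟨x, y, α.toPath⟩ : AllPaths V) ≠ ⟨z, z, .nil⟩ := fun h => by
    simpa using congrArg (fun t : AllPaths V => t.2.2.length) h
  rw [map_sub, map_sub, mul_def, mul_def, coeff_arrow_mulHom, coeff_arrow_mulHom, map_smul,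
    coeff_of, coeff_of, coeff_of, if_pos rfl, if_neg (h1 _), if_neg (h1 _)] at this
  simpa [sub_eq_zero] using this

-- A potential for the indicator of `β` separates the end points of `β` and is constant along all
-- other arrows. So `β` is no loop, no other arrow shares its end points, and no walk avoiding its
-- edge joins them.
omit [Fintype V] in
theorem isTree_of_exists_potential (hQ : IsConnected V)
    (h : ∀ φ : ∀ ⦃x y : V⦄, (x ⟶ y) → k,
      ∃ a : V → k, ∀ ⦃x y : V⦄ (α : x ⟶ y), φ α = a x - a y) : IsTree V := by
  classical
  have key (β : Arrows V) : ∃ a : V → k, a β.1 ≠ a β.2.1 ∧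
      ∀ ⦃x y : V⦄ (α : x ⟶ y), (⟨x, y, α⟩ : Arrows V) ≠ β → a x = a y := by
    obtain ⟨a, ha⟩ := h (arrowIndicator k β)
    refine ⟨a, fun he => ?_, fun x y α hα => ?_⟩
    · have := ha β.2.2
      simp [arrowIndicator, he] at this
    · have := ha α
      rw [arrowIndicator, if_neg hα] at this
      exact sub_eq_zero.1 this.symm
  refine ⟨fun x => ⟨fun α => ?_⟩, fun α β hαβ => ?_, hQ, ?_⟩
  · obtain ⟨a, ha, -⟩ := key ⟨x, x, α⟩
    exact ha rfl
  · by_contra hne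
    obtain ⟨a, ha, hb⟩ := key α
    have hb := hb β.2.2 (Ne.symm hne)
    obtain ⟨h1, h2⟩ | ⟨h1, h2⟩ := Sym2.eq_iff.1 hαβ
    · exact ha ((congrArg a h1).trans (hb.trans (congrArg a h2).symm))
    · exact ha ((congrArg a h1).trans (hb.symm.trans (congrArg a h2).symm))
  · have bridge {s t : V} (β : s ⟶ t) : (underlyingSimpleGraph V).IsBridge s(s, t) := by
      rw [SimpleGraph.isBridge_iff]
      rintro ⟨p⟩
      obtain ⟨a, ha, hb⟩ := key ⟨s, t, β⟩
      suffices hw : ∀ {x y : V}, ((underlyingSimpleGraph V).deleteEdges {s(s, t)}).Walk x y →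
          a x = a y from ha (hw p)
      intro x y p
      induction p with
      | nil => rfl
      | cons hadj p ih =>
        rw [← ih]
        rw [SimpleGraph.deleteEdges_adj, underlyingSimpleGraph, SimpleGraph.fromRel_adj] at hadj
        obtain ⟨⟨-, h | h⟩, hne⟩ := hadj
        · obtain ⟨α⟩ := h
          refine hb α fun h => hne ?_
          cases h
          rfl
        · obtain ⟨α⟩ := h
          refine (hb α fun h => hne ?_).symm
          cases h
          exact Sym2.eq_swap
    rw [SimpleGraph.isAcyclic_iff_forall_isBridge]
    intro e he
    induction e using Sym2.ind with
    | _ x y =>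
      rw [SimpleGraph.mem_edgeSet, underlyingSimpleGraph, SimpleGraph.fromRel_adj] at he
      obtain ⟨-, h | h⟩ := he
      · obtain ⟨α⟩ := h
        exact bridge α
      · obtain ⟨α⟩ := h
        rw [Sym2.eq_swap]
        exact bridge α

end OneToTree

end BoundQuiver

namespace BoundQuiver

universe u v w z

/-! ### Hochschild cohomology of quotients of path algebras of trees -/

section TreeVanishing

open PathAlgebra

variable {k : Type u} {V : Type v} [Field k] [Quiver.{w + 1} V] [Fintype V]
  {A : Type z} [Ring A] [Algebra k A] (π : PathAlgebra k V →ₐ[k] A)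

/-- The stationary path at a vertex. -/
abbrev nilPath (x : V) : AllPaths V := ⟨x, x, .nil⟩

/-- The path given by an arrow. -/
abbrev arrowPath (α : Arrows V) : AllPaths V := ⟨α.1, α.2.1, α.2.2.toPath⟩

open Classical in
theorem map_nilPath_mul (x : V) (p : AllPaths V) :
    π (of k (nilPath x)) * π (of k p) = if x = p.1 then π (of k p) else 0 := by
  obtain ⟨a, b, p⟩ := p
  rw [← map_mul, mul_def, mulHom_of_of]
  split_ifs with h
  · subst h
    rw [pathMul_comp, Quiver.Path.nil_comp]
  · rw [pathMul_of_ne _ _ (Ne.symm h), map_zero]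

open Classical in
theorem map_mul_nilPath (x : V) (p : AllPaths V) :
    π (of k p) * π (of k (nilPath x)) = if p.2.1 = x then π (of k p) else 0 := by
  obtain ⟨a, b, p⟩ := p
  rw [← map_mul, mul_def, mulHom_of_of]
  split_ifs with h
  · subst h
    rw [pathMul_comp, Quiver.Path.comp_nil]
  · rw [pathMul_of_ne _ _ (Ne.symm h), map_zero]

theorem map_mul_comp {a b c : V} (p : Quiver.Path a b) (q : Quiver.Path b c) :
    π (of k ⟨a, b, p⟩) * π (of k ⟨b, c, q⟩) = π (of k ⟨a, c, p.comp q⟩) := by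
  rw [← map_mul, mul_def, mulHom_of_of, pathMul_comp]

theorem sum_map_nilPath : ∑ x : V, π (of k (nilPath x)) = 1 := by
  rw [← map_sum, ← one_def, map_one]

/-- The pure tensor of two paths in the enveloping algebra. -/
noncomputable def pathTensor (p q : AllPaths V) : A ⊗[k] Aᵐᵒᵖ :=
  π (of k p) ⊗ₜ MulOpposite.op (π (of k q))

variable (k A) in
/-- The bilinear action of the enveloping algebra on the algebra. -/
noncomputable def envAct : A ⊗[k] Aᵐᵒᵖ →ₗ[k] A →ₗ[k] A := TensorProduct.Algebra.moduleAux

theorem smul_toRegular (r : A ⊗[k] Aᵐᵒᵖ) (x : A) :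
    r • toRegular k A x = toRegular k A (envAct k A r x) := rfl

theorem envAct_tmul (a b x : A) : envAct k A (a ⊗ₜ MulOpposite.op b) x = a * (x * b) := rfl

theorem envAct_mul (r s : A ⊗[k] Aᵐᵒᵖ) (x : A) :
    envAct k A (r * s) x = envAct k A r (envAct k A s x) :=
  (toRegular k A).injective (mul_smul r s (toRegular k A x))

open Classical in
theorem pathTensor_nil_mul (x y : V) (p q : AllPaths V) :
    pathTensor π (nilPath x) (nilPath y) * pathTensor π p q =
      if x = p.1 ∧ y = q.2.1 then pathTensor π p q else 0 := by
  rw [pathTensor, pathTensor, Algebra.TensorProduct.tmul_mul_tmul, ← MulOpposite.op_mul,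
    map_nilPath_mul, map_mul_nilPath]
  by_cases h1 : x = p.1 <;> by_cases h2 : q.2.1 = y <;> simp [h1, h2, eq_comm (a := y)]

open Classical in
theorem pathTensor_mul_nil (x y : V) (p q : AllPaths V) :
    pathTensor π p q * pathTensor π (nilPath x) (nilPath y) =
      if x = p.2.1 ∧ y = q.1 then pathTensor π p q else 0 := by
  rw [pathTensor, pathTensor, Algebra.TensorProduct.tmul_mul_tmul, ← MulOpposite.op_mul,
    map_nilPath_mul, map_mul_nilPath]
  by_cases h1 : p.2.1 = x <;> by_cases h2 : y = q.1 <;> simp [h1, h2, eq_comm (a := x)]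

open Classical in
/-- The idempotent of the enveloping algebra given by a set of pairs of vertices. -/
noncomputable def pairIdempotent (X : V → V → Prop) : A ⊗[k] Aᵐᵒᵖ :=
  ∑ x : V, ∑ y : V, if X x y then pathTensor π (nilPath x) (nilPath y) else 0

variable (X : V → V → Prop)

open Classical in
theorem pairIdempotent_mul (p q : AllPaths V) :
    pairIdempotent π X * pathTensor π p q = if X p.1 q.2.1 then pathTensor π p q else 0 := by
  simp only [pairIdempotent, Finset.sum_mul]
  rw [Finset.sum_eq_single p.1, Finset.sum_eq_single q.2.1]
  · rw [ite_mul, zero_mul, pathTensor_nil_mul, if_pos (⟨rfl, rfl⟩ : p.1 = p.1 ∧ q.2.1 = q.2.1)]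
  · intro y _ hy
    have hn : ¬ (p.1 = p.1 ∧ y = q.2.1) := fun h => hy h.2
    rw [ite_mul, zero_mul, pathTensor_nil_mul, if_neg hn, ite_self]
  · simp
  · intro x _ hx
    refine Finset.sum_eq_zero fun y _ => ?_
    have hn : ¬ (x = p.1 ∧ y = q.2.1) := fun h => hx h.1
    rw [ite_mul, zero_mul, pathTensor_nil_mul, if_neg hn, ite_self]
  · simp

open Classical in
theorem mul_pairIdempotent (p q : AllPaths V) :
    pathTensor π p q * pairIdempotent π X = if X p.2.1 q.1 then pathTensor π p q else 0 := by
  simp only [pairIdempotent, Finset.mul_sum]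
  rw [Finset.sum_eq_single p.2.1, Finset.sum_eq_single q.1]
  · rw [mul_ite, mul_zero, pathTensor_mul_nil, if_pos (⟨rfl, rfl⟩ : p.2.1 = p.2.1 ∧ q.1 = q.1)]
  · intro y _ hy
    have hn : ¬ (p.2.1 = p.2.1 ∧ y = q.1) := fun h => hy h.2
    rw [mul_ite, mul_zero, pathTensor_mul_nil, if_neg hn, ite_self]
  · simp
  · intro x _ hx
    refine Finset.sum_eq_zero fun y _ => ?_
    have hn : ¬ (x = p.2.1 ∧ y = q.1) := fun h => hx h.1
    rw [mul_ite, mul_zero, pathTensor_mul_nil, if_neg hn, ite_self]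
  · simp

theorem pairIdempotent_mul_self :
    pairIdempotent π X * pairIdempotent π X = pairIdempotent π X := by
  classical
  change (∑ x : V, ∑ y : V, if X x y then pathTensor π (nilPath x) (nilPath y) else 0) *
    pairIdempotent π X = ∑ x : V, ∑ y : V, if X x y then _ else 0
  simp only [Finset.sum_mul]
  refine Finset.sum_congr rfl fun x _ => Finset.sum_congr rfl fun y _ => ?_
  rw [ite_mul, zero_mul, mul_pairIdempotent]
  split_ifs <;> rfl

open Classical in
theorem envAct_pairIdempotent (p : AllPaths V) :
    envAct k A (pairIdempotent π X) (π (of k p)) = if X p.1 p.2.1 then π (of k p) else 0 := by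
  have key (x y : V) : envAct k A (pathTensor π (nilPath x) (nilPath y)) (π (of k p)) =
      if x = p.1 ∧ y = p.2.1 then π (of k p) else 0 := by
    rw [pathTensor, envAct_tmul, map_mul_nilPath]
    by_cases h1 : x = p.1 <;> by_cases h2 : p.2.1 = y <;>
      simp [h1, h2, map_nilPath_mul, eq_comm (a := y)]
  simp only [pairIdempotent, map_sum, LinearMap.sum_apply]
  rw [Finset.sum_eq_single p.1, Finset.sum_eq_single p.2.1]
  · split_ifs
    · rw [key, if_pos ⟨rfl, rfl⟩]
    · simp
  · intro y _ hy
    split_ifs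
    · rw [key, if_neg (fun h => hy h.2)]
    · simp
  · simp
  · intro x _ hx
    refine Finset.sum_eq_zero fun y _ => ?_
    split_ifs
    · rw [key, if_neg (fun h => hx h.1)]
    · simp
  · simp

theorem sum_pathTensor_nil :
    ∑ x : V, ∑ y : V, pathTensor π (nilPath x) (nilPath y) = 1 := by
  simp only [pathTensor, ← TensorProduct.tmul_sum, ← TensorProduct.sum_tmul, sum_map_nilPath,
    ← Finset.op_sum]
  rfl

theorem sum_pathTensor_nil_left (q : AllPaths V) :
    ∑ x : V, pathTensor π (nilPath x) q = 1 ⊗ₜ MulOpposite.op (π (of k q)) := by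
  simp only [pathTensor, ← TensorProduct.sum_tmul, sum_map_nilPath]

theorem sum_pathTensor_nil_right (p : AllPaths V) :
    ∑ x : V, pathTensor π p (nilPath x) = π (of k p) ⊗ₜ 1 := by
  simp only [pathTensor, ← TensorProduct.tmul_sum, ← Finset.op_sum, sum_map_nilPath]
  rfl

/-- The idempotent of the diagonal. -/
noncomputable abbrev diagIdempotent : A ⊗[k] Aᵐᵒᵖ := pairIdempotent π (fun x y : V => x = y)

theorem op_mul_diagIdempotent (q : AllPaths V) :
    (1 ⊗ₜ MulOpposite.op (π (of k q)) : A ⊗[k] Aᵐᵒᵖ) * diagIdempotent π =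
      pathTensor π (nilPath q.1) q := by
  classical
  rw [← sum_pathTensor_nil_left, Finset.sum_mul, Finset.sum_eq_single q.1]
  · rw [mul_pairIdempotent, if_pos rfl]
  · intro x _ hx
    rw [mul_pairIdempotent, if_neg hx]
  · simp

theorem tmul_one_mul_diagIdempotent (p : AllPaths V) :
    (π (of k p) ⊗ₜ 1 : A ⊗[k] Aᵐᵒᵖ) * diagIdempotent π = pathTensor π p (nilPath p.2.1) := by
  classical
  rw [← sum_pathTensor_nil_right, Finset.sum_mul, Finset.sum_eq_single p.2.1]
  · rw [mul_pairIdempotent, if_pos rfl]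
  · intro x _ hx
    rw [mul_pairIdempotent, if_neg (Ne.symm hx)]
  · simp

/-- The idempotent of the pairs joined by an arrow. -/
noncomputable abbrev arrowIdempotent : A ⊗[k] Aᵐᵒᵖ :=
  pairIdempotent π (fun x y : V => Nonempty (x ⟶ y))

/-- The idempotent of the pairs joined by a path that vanishes in the algebra. -/
noncomputable abbrev zeroIdempotent : A ⊗[k] Aᵐᵒᵖ :=
  pairIdempotent π (fun x y : V => ∃ p : Quiver.Path x y, π (of k ⟨x, y, p⟩) = 0)

variable [Fintype (Arrows V)]

/-- The universal relation between vertices and arrows, which generates the kernel of the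
multiplication map on the diagonal part of the enveloping algebra. -/
noncomputable def arrowRelation : A ⊗[k] Aᵐᵒᵖ :=
  ∑ α : Arrows V, (pathTensor π (arrowPath α) (nilPath α.2.1) -
    pathTensor π (nilPath α.1) (arrowPath α))

theorem arrowIdempotent_mul_arrowRelation :
    arrowIdempotent π * arrowRelation π = arrowRelation π := by
  rw [arrowRelation, Finset.mul_sum]
  refine Finset.sum_congr rfl fun α _ => ?_
  rw [mul_sub, pairIdempotent_mul, pairIdempotent_mul, if_pos ⟨α.2.2⟩, if_pos ⟨α.2.2⟩]

theorem arrowRelation_mul_diagIdempotent :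
    arrowRelation π * diagIdempotent π = arrowRelation π := by
  rw [arrowRelation, Finset.sum_mul]
  refine Finset.sum_congr rfl fun α _ => ?_
  rw [sub_mul, mul_pairIdempotent, mul_pairIdempotent, if_pos rfl, if_pos rfl]

/-- On combinations of vertices `ω` acts as the coboundary. Constant `a` shows that `ω` kills `1`,
indicator potentials isolate single arrows, and general potentials solve the extension problem in
degree one. -/
theorem envAct_arrowRelation (a : V → k) :
    envAct k A (arrowRelation π) (∑ x : V, a x • π (of k (nilPath x))) =
      ∑ α : Arrows V, (a α.2.1 - a α.1) • π (of k (arrowPath α)) := by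
  classical
  rw [arrowRelation, map_sum (envAct k A), LinearMap.sum_apply]
  refine Finset.sum_congr rfl fun α _ => ?_
  have h1 : (∑ x : V, a x • π (of k (nilPath x))) * π (of k (nilPath α.2.1)) =
      a α.2.1 • π (of k (nilPath α.2.1)) := by
    simp [Finset.sum_mul, map_nilPath_mul]
  have h2 : (∑ x : V, a x • π (of k (nilPath x))) * π (of k (arrowPath α)) =
      a α.1 • π (of k (arrowPath α)) := by
    simp [Finset.sum_mul, map_nilPath_mul]
  rw [map_sub, LinearMap.sub_apply, pathTensor, pathTensor, envAct_tmul, envAct_tmul, h1, h2,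
    mul_smul_comm, mul_smul_comm, map_mul_nilPath, map_nilPath_mul, if_pos rfl, if_pos rfl,
    sub_smul]

theorem envAct_arrowRelation_one : envAct k A (arrowRelation π) 1 = 0 := by
  have := envAct_arrowRelation π (fun _ => 1)
  simpa [sum_map_nilPath] using this

/-! ### Presentation of the regular bimodule over a tree -/

section Surjective

variable {π} (hπ : Function.Surjective π)
include hπ

omit [Fintype (Arrows V)] in
theorem induction_map_of {P : A → Prop} (a : A) (h0 : P 0)
    (hadd : ∀ a b, P a → P b → P (a + b)) (hsmul : ∀ (c : k) (p : AllPaths V), P (c • π (of k p))) :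
    P a := by
  obtain ⟨f, rfl⟩ := hπ a
  induction f using induction_of with
  | h0 => rwa [map_zero]
  | hadd f g hf hg => rw [map_add]; exact hadd _ _ hf hg
  | hsmul c p => rw [map_smul]; exact hsmul c p

omit [Fintype (Arrows V)] in
theorem induction_pathTensor {P : A ⊗[k] Aᵐᵒᵖ → Prop} (r : A ⊗[k] Aᵐᵒᵖ) (h0 : P 0)
    (hadd : ∀ r s, P r → P s → P (r + s))
    (hsmul : ∀ (c : k) (p q : AllPaths V), P (c • pathTensor π p q)) : P r := by
  induction r using TensorProduct.induction_on with
  | zero => exact h0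
  | add r s hr hs => exact hadd r s hr hs
  | tmul a b =>
    obtain ⟨b, rfl⟩ := MulOpposite.op_surjective b
    induction a using induction_map_of hπ with
    | h0 => rwa [TensorProduct.zero_tmul]
    | hadd a a' h h' => rw [TensorProduct.add_tmul]; exact hadd _ _ h h'
    | hsmul c p =>
      induction b using induction_map_of hπ with
      | h0 => rwa [MulOpposite.op_zero, TensorProduct.tmul_zero]
      | hadd b b' h h' => rw [MulOpposite.op_add, TensorProduct.tmul_add]; exact hadd _ _ h h'
      | hsmul d q =>
        rw [MulOpposite.op_smul, TensorProduct.tmul_smul, ← TensorProduct.smul_tmul', smul_smul]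
        exact hsmul _ p q

variable (hT : IsTree V)
include hT

/-- The map `b ↦ 1 ⊗ b - b ⊗ 1` obeys a Leibniz rule, which reduces paths to arrows. -/
theorem op_sub_mul_mem_span (b : A) :
    ((1 ⊗ₜ MulOpposite.op b - b ⊗ₜ 1 : A ⊗[k] Aᵐᵒᵖ) * diagIdempotent π) ∈
      Ideal.span {arrowRelation π} := by
  classical
  induction b using induction_map_of hπ with
  | h0 => simp
  | hadd a b ha hb =>
    have e : (1 ⊗ₜ MulOpposite.op (a + b) - (a + b) ⊗ₜ 1 : A ⊗[k] Aᵐᵒᵖ) =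
        (1 ⊗ₜ MulOpposite.op a - a ⊗ₜ 1) + (1 ⊗ₜ MulOpposite.op b - b ⊗ₜ 1) := by
      rw [MulOpposite.op_add, TensorProduct.tmul_add, TensorProduct.add_tmul]
      abel
    rw [e, add_mul]
    exact add_mem ha hb
  | hsmul c p =>
    have e : (1 ⊗ₜ MulOpposite.op (c • π (of k p)) - (c • π (of k p)) ⊗ₜ 1 : A ⊗[k] Aᵐᵒᵖ) =
        (c • (1 : A ⊗[k] Aᵐᵒᵖ)) * (1 ⊗ₜ MulOpposite.op (π (of k p)) - π (of k p) ⊗ₜ 1) := by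
      rw [smul_mul_assoc, one_mul, smul_sub, MulOpposite.op_smul, TensorProduct.tmul_smul,
        TensorProduct.smul_tmul', TensorProduct.smul_tmul']
    rw [e, mul_assoc]
    refine Ideal.mul_mem_left _ _ ?_
    clear e
    obtain ⟨x, y, p⟩ := p
    induction p with
    | nil =>
      rw [sub_mul, op_mul_diagIdempotent, tmul_one_mul_diagIdempotent, sub_self]
      exact zero_mem _
    | @cons y z p α ih =>
      have hα : ((1 ⊗ₜ MulOpposite.op (π (of k (arrowPath ⟨y, z, α⟩))) -
          π (of k (arrowPath ⟨y, z, α⟩)) ⊗ₜ 1 : A ⊗[k] Aᵐᵒᵖ) * diagIdempotent π) ∈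
            Ideal.span {arrowRelation π} := by
        rw [sub_mul, op_mul_diagIdempotent, tmul_one_mul_diagIdempotent, ← neg_mem_iff, neg_sub]
        -- Without parallel arrows, this idempotent cuts out of `ω` exactly the summand of `α`.
        refine Ideal.mem_span_singleton'.2 ⟨pathTensor π (nilPath y) (nilPath z), ?_⟩
        rw [arrowRelation, Finset.mul_sum, Finset.sum_eq_single (⟨y, z, α⟩ : Arrows V)]
        · rw [mul_sub, pathTensor_nil_mul, pathTensor_nil_mul, if_pos ⟨rfl, rfl⟩,
            if_pos ⟨rfl, rfl⟩]
        · intro β _ hβ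
          have hne : ¬ (y = β.1 ∧ z = β.2.1) := fun h =>
            hβ (hT.no_multiple (congrArg₂ (fun a b => s(a, b)) h.1.symm h.2.symm))
          rw [mul_sub, pathTensor_nil_mul, pathTensor_nil_mul, if_neg hne, if_neg hne, sub_zero]
        · simp
      have e : π (of k ⟨x, z, p.cons α⟩) = π (of k ⟨x, y, p⟩) * π (of k (arrowPath ⟨y, z, α⟩)) :=
        (map_mul_comp π p α.toPath).symm
      rw [e]
      generalize π (of k ⟨x, y, p⟩) = a at ih
      generalize π (of k (arrowPath ⟨y, z, α⟩)) = b at hα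
      have e2 : (1 ⊗ₜ MulOpposite.op (a * b) - (a * b) ⊗ₜ 1 : A ⊗[k] Aᵐᵒᵖ) =
          (1 ⊗ₜ MulOpposite.op b) * (1 ⊗ₜ MulOpposite.op a - a ⊗ₜ 1) +
            (a ⊗ₜ 1) * (1 ⊗ₜ MulOpposite.op b - b ⊗ₜ 1) := by
        simp only [mul_sub, Algebra.TensorProduct.tmul_mul_tmul, one_mul, mul_one,
          MulOpposite.op_mul]
        abel
      rw [e2, add_mul, mul_assoc, mul_assoc]
      exact add_mem (Ideal.mul_mem_left _ _ ih) (Ideal.mul_mem_left _ _ hα)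

/-- Modulo `Rω`, the right tensor factor can be moved to the left. If `r` kills `1`, this puts `r *
e` in `Rω`. -/
theorem mul_diagIdempotent_sub_mem_span (r : A ⊗[k] Aᵐᵒᵖ) :
    (r - envAct k A r 1 ⊗ₜ 1) * diagIdempotent π ∈ Ideal.span {arrowRelation π} := by
  induction r using TensorProduct.induction_on with
  | zero => simp
  | add r s hr hs =>
    rw [map_add, LinearMap.add_apply, TensorProduct.add_tmul, add_sub_add_comm, add_mul]
    exact add_mem hr hs
  | tmul a b =>
    obtain ⟨b, rfl⟩ := MulOpposite.op_surjective b
    have e : (a ⊗ₜ MulOpposite.op b - envAct k A (a ⊗ₜ MulOpposite.op b) 1 ⊗ₜ 1 :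
        A ⊗[k] Aᵐᵒᵖ) = (a ⊗ₜ 1) * (1 ⊗ₜ MulOpposite.op b - b ⊗ₜ 1) := by
      rw [envAct_tmul, one_mul, mul_sub, Algebra.TensorProduct.tmul_mul_tmul,
        Algebra.TensorProduct.tmul_mul_tmul, one_mul, mul_one, mul_one]
    rw [e, mul_assoc]
    exact Ideal.mul_mem_left _ _ (op_sub_mul_mem_span hπ hT b)

-- Uniqueness of paths makes each corner of the enveloping algebra at most one-dimensional.
omit [Fintype (Arrows V)] in
theorem exists_smul_pathTensor [Finite (Arrows V)] {a b c d : V} (p : Quiver.Path a b)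
    (q : Quiver.Path c d) (r : A ⊗[k] Aᵐᵒᵖ) :
    ∃ t : k, pathTensor π (nilPath a) (nilPath d) * r * pathTensor π (nilPath b) (nilPath c) =
      t • pathTensor π ⟨a, b, p⟩ ⟨c, d, q⟩ := by
  classical
  induction r using induction_pathTensor hπ with
  | h0 => exact ⟨0, by simp⟩
  | hadd r s hr hs =>
    obtain ⟨t, ht⟩ := hr
    obtain ⟨t', ht'⟩ := hs
    exact ⟨t + t', by rw [mul_add, add_mul, ht, ht', add_smul]⟩
  | hsmul m p' q' =>
    obtain ⟨a', b', p'⟩ := p'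
    obtain ⟨c', d', q'⟩ := q'
    rw [mul_smul_comm, pathTensor_nil_mul, smul_mul_assoc, ite_mul, zero_mul, pathTensor_mul_nil]
    split_ifs with h h'
    · obtain ⟨rfl, rfl⟩ := h
      obtain ⟨rfl, rfl⟩ := h'
      exact ⟨m, by rw [hT.path_unique p p', hT.path_unique q q']⟩
    · exact ⟨0, by simp⟩
    · exact ⟨0, by simp⟩

omit [Fintype (Arrows V)] hT in
theorem pathTensor_mul_mul_eq_zero {a b c d : V}
    (h : ¬ (Nonempty (Quiver.Path a b) ∧ Nonempty (Quiver.Path c d))) (r : A ⊗[k] Aᵐᵒᵖ) :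
    pathTensor π (nilPath a) (nilPath d) * r * pathTensor π (nilPath b) (nilPath c) = 0 := by
  classical
  induction r using induction_pathTensor hπ with
  | h0 => simp
  | hadd r s hr hs => rw [mul_add, add_mul, hr, hs, add_zero]
  | hsmul m p' q' =>
    obtain ⟨a', b', p'⟩ := p'
    obtain ⟨c', d', q'⟩ := q'
    rw [mul_smul_comm, pathTensor_nil_mul, smul_mul_assoc, ite_mul, zero_mul, pathTensor_mul_nil]
    split_ifs with h1 h2
    · obtain ⟨rfl, rfl⟩ := h1
      obtain ⟨rfl, rfl⟩ := h2
      exact absurd ⟨⟨p'⟩, ⟨q'⟩⟩ h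
    · simp
    · simp

theorem zeroIdempotent_mul_of_mul_arrowRelation_eq_zero {r : A ⊗[k] Aᵐᵒᵖ}
    (hrf : r * arrowIdempotent π = r) (hr : r * arrowRelation π = 0) :
    zeroIdempotent π * r = r := by
  classical
  -- Apply `r * ω = 0` to a combination of vertices whose coboundary is the indicator of `α`.
  have hα (α : Arrows V) : envAct k A r (π (of k (arrowPath α))) = 0 := by
    obtain ⟨a, ha⟩ := hT.exists_potential_arrowIndicator k α
    have h := congrArg (fun s => envAct k A s (∑ x : V, a x • π (of k (nilPath x)))) hr
    simp only [map_zero, LinearMap.zero_apply] at h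
    rw [envAct_mul, envAct_arrowRelation, Finset.sum_eq_single α] at h
    · rw [← ha α.2.2] at h
      simpa [arrowIndicator] using h
    · intro β _ hβ
      rw [← ha β.2.2, arrowIndicator, if_neg hβ, zero_smul]
    · simp
  -- A corner of `r` at an arrow `α : b ⟶ c` is `t • (p ⊗ q)`. As `r` kills `α`, `t` times the path
  -- `pαq` from `x` to `y` is zero in `A`; that path survives, so `t = 0`.
  have hzero (x y : V) (hxy : ¬ ∃ p : Quiver.Path x y, π (of k ⟨x, y, p⟩) = 0) :
      pathTensor π (nilPath x) (nilPath y) * r = 0 := by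
    rw [← hrf]
    simp only [arrowIdempotent, pairIdempotent, Finset.mul_sum]
    refine Finset.sum_eq_zero fun b _ => Finset.sum_eq_zero fun c _ => ?_
    split_ifs with hbc
    · obtain ⟨α⟩ := hbc
      rw [← mul_assoc]
      by_cases hp : Nonempty (Quiver.Path x b) ∧ Nonempty (Quiver.Path c y)
      · obtain ⟨⟨p⟩, ⟨q⟩⟩ := hp
        obtain ⟨t, ht⟩ := exists_smul_pathTensor hπ hT p q r
        have h := congrArg (fun s => envAct k A s (π (of k (arrowPath ⟨b, c, α⟩)))) ht
        have e1 : envAct k A (pathTensor π (nilPath b) (nilPath c))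
            (π (of k (arrowPath ⟨b, c, α⟩))) = π (of k (arrowPath ⟨b, c, α⟩)) := by
          rw [pathTensor, envAct_tmul, map_mul_nilPath, if_pos rfl, map_nilPath_mul, if_pos rfl]
        have e2 : envAct k A (pathTensor π ⟨x, b, p⟩ ⟨c, y, q⟩)
            (π (of k (arrowPath ⟨b, c, α⟩))) =
              π (of k ⟨x, y, p.comp (α.toPath.comp q)⟩) := by
          rw [pathTensor, envAct_tmul, map_mul_comp, map_mul_comp]
        simp only [envAct_mul, map_smul, LinearMap.smul_apply] at h
        rw [e1, hα, map_zero, e2] at h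
        obtain ht0 | h0 := smul_eq_zero.1 h.symm
        · rw [ht, ht0, zero_smul]
        · exact absurd ⟨_, h0⟩ hxy
      · exact pathTensor_mul_mul_eq_zero hπ hp r
    · rw [mul_zero, mul_zero]
  conv_rhs => rw [← one_mul r, ← sum_pathTensor_nil π]
  simp only [zeroIdempotent, pairIdempotent, Finset.sum_mul]
  refine Finset.sum_congr rfl fun x _ => Finset.sum_congr rfl fun y _ => ?_
  split_ifs with h
  · rfl
  · rw [zero_mul, hzero x y h]

-- Extending a vanishing path on both sides gives a vanishing path.
omit [Fintype (Arrows V)] hT in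
theorem zeroIdempotent_mul_mul (r : A ⊗[k] Aᵐᵒᵖ) :
    zeroIdempotent π * (r * zeroIdempotent π) = r * zeroIdempotent π := by
  classical
  induction r using induction_pathTensor hπ with
  | h0 => simp
  | hadd r s hr hs => rw [add_mul, mul_add, hr, hs]
  | hsmul m p q =>
    obtain ⟨a, b, p⟩ := p
    obtain ⟨c, d, q⟩ := q
    rw [smul_mul_assoc, mul_pairIdempotent, mul_smul_comm]
    split_ifs with h
    · obtain ⟨w, hw⟩ := h
      rw [pairIdempotent_mul, if_pos ⟨p.comp (w.comp q), by
        rw [← map_mul_comp, ← map_mul_comp, hw, zero_mul, mul_zero]⟩]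
    · rw [mul_zero]

-- If one path from `x` to `y` vanishes then all do, by uniqueness.
omit [Fintype (Arrows V)] in
theorem envAct_zeroIdempotent [Finite (Arrows V)] (a : A) :
    envAct k A (zeroIdempotent π) a = 0 := by
  classical
  induction a using induction_map_of hπ with
  | h0 => simp
  | hadd a b ha hb => rw [map_add, ha, hb, add_zero]
  | hsmul c p =>
    rw [map_smul, envAct_pairIdempotent]
    split_ifs with h
    · obtain ⟨w, hw⟩ := h
      obtain ⟨x, y, p⟩ := p
      rw [hT.path_unique p w, hw, smul_zero]
    · rw [smul_zero]

/-- The only path parallel to an arrow of a tree is that arrow. -/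
theorem exists_envAct_arrowIdempotent (a : A) :
    ∃ c : Arrows V → k,
      envAct k A (arrowIdempotent π) a = ∑ α : Arrows V, c α • π (of k (arrowPath α)) := by
  classical
  induction a using induction_map_of hπ with
  | h0 => exact ⟨0, by simp⟩
  | hadd a b ha hb =>
    obtain ⟨c, hc⟩ := ha
    obtain ⟨d, hd⟩ := hb
    exact ⟨c + d, by simp [hc, hd, add_smul, Finset.sum_add_distrib]⟩
  | hsmul t p =>
    obtain ⟨x, y, p⟩ := p
    rw [map_smul, envAct_pairIdempotent]
    split_ifs with h
    · obtain ⟨α⟩ := h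
      refine ⟨Pi.single ⟨x, y, α⟩ t, ?_⟩
      rw [Finset.sum_eq_single (⟨x, y, α⟩ : Arrows V)]
      · rw [Pi.single_eq_same, hT.path_unique p α.toPath]
      · intro β _ hβ
        rw [Pi.single_eq_of_ne hβ, zero_smul]
      · simp
    · exact ⟨0, by simp⟩

/-- All higher Hochschild cohomology groups of a quotient of the path algebra of a tree vanish. -/
theorem subsingleton_HH_of_isTree {n : ℕ} (hn : 0 < n) : Subsingleton (HH k A n) := by
  refine subsingleton_ext_self (regularBimodule k A) (toRegular k A 1)
    (e := diagIdempotent π) (f := arrowIdempotent π) (ε := zeroIdempotent π)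
    (ω := arrowRelation π) (fun x => ?_) (pairIdempotent_mul_self π _) ?_
    (pairIdempotent_mul_self π _) (arrowIdempotent_mul_arrowRelation π)
    (arrowRelation_mul_diagIdempotent π) ?_ (fun r hr => ?_)
    (fun r => zeroIdempotent_mul_of_mul_arrowRelation_eq_zero hπ hT)
    (zeroIdempotent_mul_mul hπ) (fun x => ?_) (fun x hx => ?_) hn
  · obtain ⟨x, rfl⟩ := (toRegular k A).surjective x
    exact ⟨x ⊗ₜ MulOpposite.op 1, by rw [tmul_smul_toRegular, mul_one, mul_one]⟩
  · rw [smul_toRegular, ← sum_map_nilPath π, map_sum]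
    simp only [envAct_pairIdempotent, if_true]
  · rw [smul_toRegular, envAct_arrowRelation_one, map_zero]
  · have hr : envAct k A r 1 = 0 :=
      (toRegular k A).injective ((smul_toRegular r 1).symm.trans (hr.trans (map_zero _).symm))
    have h := mul_diagIdempotent_sub_mem_span hπ hT r
    rw [hr, TensorProduct.zero_tmul, sub_zero] at h
    obtain ⟨s, hs⟩ := Ideal.mem_span_singleton'.1 h
    exact ⟨s, hs.symm⟩
  · obtain ⟨x, rfl⟩ := (toRegular k A).surjective x
    rw [smul_toRegular, envAct_zeroIdempotent hπ hT, map_zero]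
  · obtain ⟨x, rfl⟩ := (toRegular k A).surjective x
    obtain ⟨c, hc⟩ := exists_envAct_arrowIdempotent hπ hT x
    rw [smul_toRegular] at hx
    obtain ⟨a, ha⟩ := hT.exists_potential (R := k) fun x y α => c ⟨x, y, α⟩
    refine ⟨toRegular k A (∑ x : V, a x • π (of k (nilPath x))), ?_⟩
    rw [smul_toRegular, envAct_arrowRelation, ← hx, hc]
    refine congrArg _ (Finset.sum_congr rfl fun α _ => ?_)
    rw [← ha α.2.2]

end Surjective

end TreeVanishing

end BoundQuiver

theorem corollary6p6 {k : Type*} {V : Type*} [Field k] [Quiver V] [Fintype V]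
    [∀ x y : V, Finite (x ⟶ y)] (hQ : BoundQuiver.IsConnected V)
    (I : TwoSidedIdeal (BoundQuiver.PathAlgebra k V))
    (hI : BoundQuiver.IsAdmissible I) (hmon : BoundQuiver.IsMonomial I) :
    List.TFAE [
      ∀ i : ℕ, 0 < i → Subsingleton (BoundQuiver.HH k (BoundQuiver.BoundQuiverAlgebra I) i),
      Subsingleton (BoundQuiver.HH k (BoundQuiver.BoundQuiverAlgebra I) 1),
      BoundQuiver.IsTree V] := by
  tfae_have 1 → 2 := fun h => h 1 one_pos
  tfae_have 2 → 3 := fun h => BoundQuiver.isTree_of_exists_potential hQ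
    (BoundQuiver.exists_potential_of_subsingleton_HH_one hI hmon h)
  tfae_have 3 → 1 := fun hT i hi => by
    have := Fintype.ofFinite (BoundQuiver.Arrows V)
    exact BoundQuiver.subsingleton_HH_of_isTree
      (π := Ideal.Quotient.mkₐ k (TwoSidedIdeal.asIdeal I))
      (Ideal.Quotient.mkₐ_surjective k _) hT hi
  tfae_finish
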